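/- Let $D\in\mathbb N$, $\lambda>0$, $\phi\in(0,\pi/2]$, and put $c_1=\frac{\lambda^{-1}}{4}\sin^2\phi$, $c_2=\lambda^{-1}c_1(1-\cos\phi)$. Let $\Phi\in C^2(\mathbb R^D)$ satisfy (H1) $\Phi\ge 0$ and $\int_{\mathbb R^D}|q|^2e^{-\Phi(q)}\,dq<\infty$; (H2) there are $a>0$ and $b\in(0,1)$ such that $\frac12\langle\nabla\Phi(q),q\rangle\ge b\,\Phi(q)+\frac{(c_1b)^2+c_2b(1-b)}{2(1-b)}|q|^2-a$ for all $q\in\mathbb R^D$. Let $Z_t=(Q_t,P_t)$, $t\ge0$, be the randomized Hamiltonian Monte Carlo process on $\mathbb R^{2D}$ with mean duration $\lambda$ and angle $\phi$: started at $Z_0=z$, it follows Hamilton's equations $\dot q=p$, $\dot p=-\nabla\Phi(q)$ (whose solutions exist for all times) between the successive times $t_n=\delta t_0+\dots+\delta t_{n-1}$, $n\ge1$, and at time $t_n$ its momentum $p$ is replaced by $\cos(\phi)\,p+\sin(\phi)\,\xi_{n-1}$; here $\delta t_0,\delta t_1,\dots$ are exponential random variables with mean $\lambda$, $\xi_0,\xi_1,\dots$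 are standard normal vectors in $\mathbb R^D$, and all of them are independent. Let $\Pi_{t,z}$ be the law of $Z_t$ given $Z_0=z$. Then for every compact set $\Omega\subset\mathbb R^{2D}$ there exist a probability measure $\eta$ on $\mathbb R^{2D}$, $\epsilon>0$ and $t>0$ such that $$\Pi_{t,z}(A)\ \ge\ \epsilon\,\eta(A)\qquad\text{for all } z\in\Omega\text{ and all Borel sets }A\subset\mathbb R^{2D}.$$ If $\Omega$ has positive Lebesgue measure, then $\eta$ can moreover be chosen with $\eta(\Omega)=1$. -/

import Mathlib

open MeasureTheory ProbabilityTheory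

noncomputable section

namespace RHMC

/-- The phase space `ℝ^{2D}`, with points `z = (q, p)`. -/
abbrev Phase (D : ℕ) : Type := EuclideanSpace ℝ (Fin D) × EuclideanSpace ℝ (Fin D)

variable {D : ℕ}

/-- The constant `c₁ = λ⁻¹ sin² φ / 4`. -/
def c₁ (lam phi : ℝ) : ℝ := lam⁻¹ / 4 * Real.sin phi ^ 2

/-- The constant `c₂ = λ⁻¹ c₁ (1 - cos φ)`. -/
def c₂ (lam phi : ℝ) : ℝ := lam⁻¹ * c₁ lam phi * (1 - Real.cos phi)

/-- The standing conditions on the potential energy: `Φ ∈ C²`, (H1) and (H2).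
The function in `integrable` is continuous and nonnegative, so that integrability says exactly
that its integral is finite. -/
structure PotentialHypothesis (lam phi : ℝ) (Φ : EuclideanSpace ℝ (Fin D) → ℝ) : Prop where
  contDiff : ContDiff ℝ 2 Φ
  nonneg : ∀ q, 0 ≤ Φ q
  integrable : Integrable (fun q : EuclideanSpace ℝ (Fin D) => ‖q‖ ^ 2 * Real.exp (-Φ q))
  drift : ∃ a b : ℝ, 0 < a ∧ 0 < b ∧ b < 1 ∧ ∀ q : EuclideanSpace ℝ (Fin D),
    b * Φ q + ((c₁ lam phi * b) ^ 2 + c₂ lam phi * b * (1 - b)) / (2 * (1 - b)) * ‖q‖ ^ 2 - a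
      ≤ 1 / 2 * inner ℝ (gradient Φ q) q

/-- `γ = (q, p)` solves Hamilton's equations `q' = p`, `p' = -∇Φ(q)` for all real times. -/
def IsHamiltonianTrajectory (Φ : EuclideanSpace ℝ (Fin D) → ℝ) (γ : ℝ → Phase D) : Prop :=
  ∀ s : ℝ, HasDerivAt γ ((γ s).2, -gradient Φ (γ s).1) s

open Classical in
/-- The Hamiltonian flow map: the value at time `s` of the solution of Hamilton's equations that
starts at `z` (for a nonnegative `C²` potential it exists for all times and is unique; the
value `z` is only a default for potentials without global solutions). -/
def hamiltonianFlow (Φ : EuclideanSpace ℝ (Fin D) → ℝ) (s : ℝ) (z : Phase D) : Phase D :=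
  if h : ∃ γ : ℝ → Phase D, γ 0 = z ∧ IsHamiltonianTrajectory Φ γ then h.choose s else z

/-- The momentum randomization `Γ(q, p) = (q, cos φ p + sin φ ξ)`. -/
def momentumRandomization (phi : ℝ) (z : Phase D) (ξ : EuclideanSpace ℝ (Fin D)) : Phase D :=
  (z.1, Real.cos phi • z.2 + Real.sin phi • ξ)

/-- A realization of the driving noise: the `n`-th entry is the pair `(δtₙ, ξₙ)` of the `n`-th
waiting time and of the Gaussian vector used in the randomization that ends it. -/
abbrev Noise (D : ℕ) : Type := ℕ → ℝ × EuclideanSpace ℝ (Fin D)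

/-- The law of the noise: all `δtₙ` and `ξₙ` are independent, `δtₙ` is exponential with mean `lam`
(rate `lam⁻¹`), and `ξₙ` is a standard normal vector. -/
def noiseMeasure (D : ℕ) (lam : ℝ) : Measure (Noise D) :=
  Measure.infinitePi fun _ : ℕ =>
    (expMeasure lam⁻¹).prod (stdGaussian (EuclideanSpace ℝ (Fin D)))

/-- The time `tₙ = δt₀ + ⋯ + δtₙ₋₁` of the `n`-th momentum randomization, with `t₀ = 0`. -/
def jumpTime (ω : Noise D) (n : ℕ) : ℝ := ∑ i ∈ Finset.range n, (ω i).1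

/-- The state right after the `n`-th momentum randomization, from the initial state `z`. -/
def postJumpState (phi : ℝ) (Φ : EuclideanSpace ℝ (Fin D) → ℝ) (z : Phase D) (ω : Noise D) :
    ℕ → Phase D
  | 0 => z
  | n + 1 => momentumRandomization phi
      (hamiltonianFlow Φ (ω n).1 (postJumpState phi Φ z ω n)) (ω n).2

/-- The number of momentum randomizations up to time `t`: the first `n` with `t < tₙ₊₁`
(almost surely `tₙ → ∞`, so that there is such an `n`). -/
def jumpCount (ω : Noise D) (t : ℝ) : ℕ := sInf {n : ℕ | t < jumpTime ω (n + 1)}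

/-- The RHMC process `Z_t` with `Z_0 = z`: it follows the Hamiltonian flow between consecutive
momentum randomizations. -/
def process (phi : ℝ) (Φ : EuclideanSpace ℝ (Fin D) → ℝ) (z : Phase D) (t : ℝ) (ω : Noise D) :
    Phase D :=
  hamiltonianFlow Φ (t - jumpTime ω (jumpCount ω t)) (postJumpState phi Φ z ω (jumpCount ω t))

/-- The transition probability `Π_{t,z}`: the law of `Z_t` given `Z_0 = z`. -/
def transition (lam phi : ℝ) (Φ : EuclideanSpace ℝ (Fin D) → ℝ) (t : ℝ) (z : Phase D) :
    Measure (Phase D) :=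
  (noiseMeasure D lam).map (process phi Φ z t)

end RHMC

end

/-!
Only the event that there are exactly two momentum randomizations before the time `t = 4h`, with
both waiting times in `[h, 2h]`, is needed. On it the final state is a function of the initial
state, of the two waiting times and of the two Gaussian vectors (`twoJumpState`). For fixed waiting
times this function maps a ball of pairs of Gaussian vectors onto a set that contains the given
bounded set (`exists_lipschitzOnWith_twoJumpState`): the second randomization sets the final
momentum freely, and the first one sets the momentum that carries the position to its target. Such
a momentum exists because, over a short time, the position depends on the momentum almost as in
free motion, so that a contraction argument applies (`exists_momentum_fst_hamiltonianFlow_eq`).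

On the ball the function is Lipschitz, with a constant that is uniform in the initial state and the
waiting times, and the Gaussian density is bounded below there. A Lipschitz map between spaces of
the same dimension increases Lebesgue measure by at most a constant factor; as the map is onto, its
image of the Gaussian law dominates a multiple of Lebesgue measure on the bounded set
(`smul_restrict_le_map_of_lipschitzOnWith`). This takes the place of a computation of Jacobians
and of the preservation of volume by the flow. Integration over the waiting times gives the
minorization by Lebesgue measure restricted to the set (`exists_smul_restrict_le_transition`).

The properties of the flow (global existence, Lipschitz bounds, joint continuity) come from
conservation of energy: as the potential is nonnegative, the energy bounds the momentum, hence the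
distance travelled, and the solutions agree with those of a potential cut off far away, whose
gradient is globally Lipschitz.
-/

noncomputable section

namespace RHMC

open Set Metric Filter Topology
open scoped NNReal ENNReal Manifold

/-! ### Ordinary differential equations -/

section ODE

variable {E : Type*} [NormedAddCommGroup E] [NormedSpace ℝ E]

theorem isMIntegralCurveOn_of_hasDerivAt {V : E → E} {γ : ℝ → E} {s : Set ℝ}
    (h : ∀ t ∈ s, HasDerivAt γ (V (γ t)) t) :
    IsMIntegralCurveOn (I := 𝓘(ℝ, E)) γ V s :=
  fun t ht => (h t ht).hasFDerivAt.hasFDerivWithinAt.hasMFDerivWithinAt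

theorem hasDerivAt_of_isMIntegralCurve {V : E → E} {γ : ℝ → E}
    (h : IsMIntegralCurve (I := 𝓘(ℝ, E)) γ V) (t : ℝ) : HasDerivAt γ (V (γ t)) t := by
  have h' : HasFDerivAt γ ((1 : ℝ →L[ℝ] ℝ).smulRight (V (γ t))) t :=
    hasMFDerivAt_iff_hasFDerivAt.1 (h t)
  simpa using h'.hasDerivAt

/-- Solutions on all intervals `(-a, a)` glue to a solution on the whole line. -/
theorem exists_forall_hasDerivAt_of_forall_Ioo {V : E → E} [CompleteSpace E] (hV : ContDiff ℝ 1 V)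
    {x : E} (h : ∀ a : ℝ, ∃ γ : ℝ → E, γ 0 = x ∧ ∀ t ∈ Ioo (-a) a, HasDerivAt γ (V (γ t)) t) :
    ∃ γ : ℝ → E, γ 0 = x ∧ ∀ t, HasDerivAt γ (V (γ t)) t := by
  obtain ⟨γ, h0, hγ⟩ := (exists_isMIntegralCurve_iff_exists_isMIntegralCurveOn_Ioo
    (I := 𝓘(ℝ, E)) (v := V) (contMDiff_vectorSpace_iff_contDiff.2 hV) x).2 fun a => by
      obtain ⟨γ, h0, hγ⟩ := h a
      exact ⟨γ, h0, isMIntegralCurveOn_of_hasDerivAt hγ⟩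
  exact ⟨γ, h0, hasDerivAt_of_isMIntegralCurve hγ⟩

/-- A globally Lipschitz `C¹` vector field has global solutions: the time of existence given by
the Picard-Lindelöf theorem is at least `1 / (1 + K)` at every point. -/
theorem exists_forall_hasDerivAt_of_lipschitzWith [CompleteSpace E] {V : E → E}
    (hV : ContDiff ℝ 1 V) {K : ℝ≥0} (hK : LipschitzWith K V) (x : E) :
    ∃ γ : ℝ → E, γ 0 = x ∧ ∀ t, HasDerivAt γ (V (γ t)) t := by
  have hpos : (0 : ℝ) < 1 / (1 + K) := by positivity
  obtain ⟨γ, h0, hγ⟩ := exists_isMIntegralCurve_of_isMIntegralCurveOn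
    (I := 𝓘(ℝ, E)) (v := V) (contMDiff_vectorSpace_iff_contDiff.2 hV) hpos (fun y => by
      have h0 : (0 : ℝ) ∈ Icc (-(1 / (1 + K) : ℝ)) (1 / (1 + K)) := ⟨by linarith, hpos.le⟩
      have hPL : IsPicardLindelof (fun _ => V) (⟨0, h0⟩ : Icc (-(1 / (1 + K) : ℝ)) (1 / (1 + K)))
          y (‖V y‖₊ + 1) 0 ((1 + K) * (‖V y‖₊ + 1)) K := by
        refine IsPicardLindelof.of_time_independent (fun z hz => ?_) hK.lipschitzOnWith ?_
        · have h1 : ‖V z - V y‖ ≤ K * ‖z - y‖ := hK.norm_sub_le z y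
          have h2 : ‖z - y‖ ≤ ‖V y‖ + 1 := by simpa [mem_closedBall, dist_eq_norm] using hz
          have h3 : ‖V z‖ ≤ ‖V z - V y‖ + ‖V y‖ := by simpa using norm_add_le (V z - V y) (V y)
          have h4 : (K : ℝ) * ‖z - y‖ ≤ K * (‖V y‖ + 1) := by gcongr
          push_cast
          linarith
        · have : (1 + (K : ℝ)) ≠ 0 := by positivity
          simp only [sub_zero, zero_sub, neg_neg, max_self]
          push_cast
          rw [sub_zero]
          apply le_of_eq
          field_simp
      obtain ⟨γ, h0, hγ⟩ := hPL.exists_eq_forall_mem_Icc_hasDerivWithinAt₀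
      exact ⟨γ, h0, isMIntegralCurveOn_of_hasDerivAt fun t ht =>
        (hγ t (Ioo_subset_Icc_self ht)).hasDerivAt (Icc_mem_nhds ht.1 ht.2)⟩) x
  exact ⟨γ, h0, hasDerivAt_of_isMIntegralCurve hγ⟩

/-- **Grönwall's inequality** in both time directions, for two solutions that stay in a set on
which the vector field is Lipschitz. -/
theorem dist_le_mul_exp_of_mem {V : E → E} {K : ℝ≥0} {S : Set E} (hV : LipschitzOnWith K V S)
    {γ γ' : ℝ → E} {T : ℝ}
    (h : ∀ t, |t| ≤ T → HasDerivAt γ (V (γ t)) t) (hS : ∀ t, |t| ≤ T → γ t ∈ S)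
    (h' : ∀ t, |t| ≤ T → HasDerivAt γ' (V (γ' t)) t) (hS' : ∀ t, |t| ≤ T → γ' t ∈ S)
    {t : ℝ} (ht : |t| ≤ T) :
    dist (γ t) (γ' t) ≤ dist (γ 0) (γ' 0) * Real.exp (K * |t|) := by
  -- Forward statement for an arbitrary field, so that it applies to the time reversal as well.
  have key : ∀ (W : E → E), LipschitzOnWith K W S → ∀ δ δ' : ℝ → E,
      (∀ t, |t| ≤ T → HasDerivAt δ (W (δ t)) t) → (∀ t, |t| ≤ T → δ t ∈ S) →
      (∀ t, |t| ≤ T → HasDerivAt δ' (W (δ' t)) t) → (∀ t, |t| ≤ T → δ' t ∈ S) →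
      ∀ t, 0 ≤ t → t ≤ T → dist (δ t) (δ' t) ≤ dist (δ 0) (δ' 0) * Real.exp (K * t) := by
    intro W hW δ δ' h hS h' hS' t ht0 htT
    have hIcc : ∀ s ∈ Icc 0 t, |s| ≤ T := fun s hs => by
      rw [abs_of_nonneg hs.1]; exact hs.2.trans htT
    have hIco : ∀ s ∈ Ico 0 t, |s| ≤ T := fun s hs => hIcc s (Ico_subset_Icc_self hs)
    have := dist_le_of_trajectories_ODE_of_mem (v := fun _ => W) (s := fun _ => S) (K := K)
      (f := δ) (g := δ') (a := 0) (b := t) (fun _ _ => hW)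
      (fun s hs => (h s (hIcc s hs)).continuousAt.continuousWithinAt)
      (fun s hs => (h s (hIco s hs)).hasDerivWithinAt) (fun s hs => hS s (hIco s hs))
      (fun s hs => (h' s (hIcc s hs)).continuousAt.continuousWithinAt)
      (fun s hs => (h' s (hIco s hs)).hasDerivWithinAt) (fun s hs => hS' s (hIco s hs))
      le_rfl t ⟨ht0, le_rfl⟩
    simpa using this
  rcases le_total 0 t with h0 | h0
  · rw [abs_of_nonneg h0] at ht ⊢
    exact key V hV γ γ' h hS h' hS' t h0 ht
  · rw [abs_of_nonpos h0] at ht ⊢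
    have hrev : ∀ δ : ℝ → E, (∀ t, |t| ≤ T → HasDerivAt δ (V (δ t)) t) →
        ∀ t, |t| ≤ T → HasDerivAt (fun s => δ (-s)) (-V (δ (-t))) t := by
      intro δ hδ t ht
      have := (hδ (-t) (by rwa [abs_neg])).scomp t (hasDerivAt_neg t)
      simpa [Function.comp_def] using this
    have := key (fun x => -V x) (LipschitzOnWith.neg hV) (fun s => γ (-s)) (fun s => γ' (-s))
      (hrev γ h) (fun s hs => hS _ (by rwa [abs_neg]))
      (hrev γ' h') (fun s hs => hS' _ (by rwa [abs_neg])) (-t) (by linarith) ht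
    simpa using this

end ODE

/-! ### The Hamiltonian flow of a nonnegative potential -/

variable {D : ℕ}

/-- The Hamiltonian vector field `(q, p) ↦ (p, -∇Φ(q))`. -/
def hamiltonianField (Φ : EuclideanSpace ℝ (Fin D) → ℝ) (z : Phase D) : Phase D :=
  (z.2, -gradient Φ z.1)

/-- The total energy `|p|² / 2 + Φ(q)`. -/
def energy (Φ : EuclideanSpace ℝ (Fin D) → ℝ) (z : Phase D) : ℝ := ‖z.2‖ ^ 2 / 2 + Φ z.1

theorem contDiff_gradient {Φ : EuclideanSpace ℝ (Fin D) → ℝ} (h : ContDiff ℝ 2 Φ) :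
    ContDiff ℝ 1 (gradient Φ) := by
  have h1 : ContDiff ℝ 1 (fderiv ℝ Φ) := h.fderiv_right (by norm_num)
  exact (InnerProductSpace.toDual ℝ (EuclideanSpace ℝ (Fin D))).symm.toContinuousLinearEquiv
    |>.contDiff.comp h1

theorem contDiff_hamiltonianField {Φ : EuclideanSpace ℝ (Fin D) → ℝ} (h : ContDiff ℝ 2 Φ) :
    ContDiff ℝ 1 (hamiltonianField Φ) :=
  contDiff_snd.prodMk ((contDiff_gradient h).comp contDiff_fst).neg

/-- Multiplying the potential by a smooth bump function gives a potential with globally Lipschitz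
gradient that lies below the given one and equals it on a prescribed ball. -/
theorem exists_cutoff {Φ : EuclideanSpace ℝ (Fin D) → ℝ} (h : ContDiff ℝ 2 Φ)
    (h0 : ∀ q, 0 ≤ Φ q) (r : ℝ) :
    ∃ Ψ : EuclideanSpace ℝ (Fin D) → ℝ, ContDiff ℝ 2 Ψ ∧ (∀ q, 0 ≤ Ψ q) ∧ (∀ q, Ψ q ≤ Φ q) ∧
      (∃ K : ℝ≥0, LipschitzWith K (gradient Ψ)) ∧ ∀ q, ‖q‖ < r → gradient Ψ q = gradient Φ q := by
  let χ : ContDiffBump (0 : EuclideanSpace ℝ (Fin D)) :=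
    ⟨|r| + 1, |r| + 2, by positivity, by linarith⟩
  have hΨ : ContDiff ℝ 2 fun q => χ q * Φ q := χ.contDiff.mul h
  refine ⟨fun q => χ q * Φ q, hΨ, fun q => mul_nonneg χ.nonneg (h0 q),
    fun q => mul_le_of_le_one_left (h0 q) χ.le_one, ?_, fun q hq => ?_⟩
  · refine ContDiff.lipschitzWith_of_hasCompactSupport (𝕂 := ℝ) ?_ (contDiff_gradient hΨ)
      one_ne_zero
    have hc : HasCompactSupport (fderiv ℝ fun q => χ q * Φ q) :=
      (χ.hasCompactSupport.mul_right).fderiv ℝ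
    exact hc.comp_left (map_zero (InnerProductSpace.toDual ℝ (EuclideanSpace ℝ (Fin D))).symm)
  · have hev : (fun q => χ q * Φ q) =ᶠ[𝓝 q] Φ := by
      have hmem : ball (0 : EuclideanSpace ℝ (Fin D)) r ∈ 𝓝 q :=
        isOpen_ball.mem_nhds (by simpa using hq)
      filter_upwards [hmem] with x hx
      have : χ x = 1 := χ.one_of_mem_closedBall <| by
        have := le_abs_self r
        simp only [mem_closedBall, mem_ball, χ] at hx ⊢
        linarith
      simp [this]
    simp only [gradient, hev.fderiv_eq]

theorem lipschitzWith_hamiltonianField {Φ : EuclideanSpace ℝ (Fin D) → ℝ} {K : ℝ≥0}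
    (hK : LipschitzWith K (gradient Φ)) : LipschitzWith (max 1 K) (hamiltonianField Φ) := by
  have h1 : LipschitzWith 1 (Prod.fst : Phase D → EuclideanSpace ℝ (Fin D)) :=
    LipschitzWith.prod_fst
  have h2 : LipschitzWith K fun z : Phase D => -gradient Φ z.1 := by
    have h3 := (hK.comp h1).neg
    rwa [mul_one] at h3
  exact LipschitzWith.prod_snd.prodMk h2

theorem exists_lipschitzOnWith_hamiltonianField {Φ : EuclideanSpace ℝ (Fin D) → ℝ}
    (h : ContDiff ℝ 2 Φ) (r : ℝ) :
    ∃ K : ℝ≥0, LipschitzOnWith K (hamiltonianField Φ) (closedBall 0 r) :=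
  (contDiff_hamiltonianField h).contDiffOn.exists_lipschitzOnWith one_ne_zero
    (convex_closedBall _ _) (isCompact_closedBall _ _)

section Trajectory

variable {Φ : EuclideanSpace ℝ (Fin D) → ℝ} {γ : ℝ → Phase D}

theorem IsHamiltonianTrajectory.hasDerivAt_fst (h : IsHamiltonianTrajectory Φ γ) (s : ℝ) :
    HasDerivAt (fun t => (γ t).1) (γ s).2 s :=
  (hasFDerivAt_fst (𝕜 := ℝ) (p := γ s)).comp_hasDerivAt s (h s)

theorem IsHamiltonianTrajectory.hasDerivAt_snd (h : IsHamiltonianTrajectory Φ γ) (s : ℝ) :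
    HasDerivAt (fun t => (γ t).2) (-gradient Φ (γ s).1) s :=
  (hasFDerivAt_snd (𝕜 := ℝ) (p := γ s)).comp_hasDerivAt s (h s)

theorem IsHamiltonianTrajectory.energy_eq (hΦ : ContDiff ℝ 2 Φ)
    (h : IsHamiltonianTrajectory Φ γ) (s : ℝ) : energy Φ (γ s) = energy Φ (γ 0) := by
  have hd : ∀ s, HasDerivAt (fun t => energy Φ (γ t)) 0 s := by
    intro s
    have h1 := (h.hasDerivAt_snd s).norm_sq
    have h2 : HasGradientAt Φ (gradient Φ (γ s).1) (γ s).1 :=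
      (hΦ.differentiable (by norm_num) _).hasGradientAt
    have h3 := h2.hasFDerivAt.comp_hasDerivAt s (h.hasDerivAt_fst s)
    refine ((h1.div_const 2).add h3).congr_deriv ?_
    simp
    ring
  exact is_const_of_deriv_eq_zero (fun s => (hd s).differentiableAt) (fun s => (hd s).deriv) s 0

theorem IsHamiltonianTrajectory.norm_snd_le (hΦ : ContDiff ℝ 2 Φ) (h0 : ∀ q, 0 ≤ Φ q)
    (h : IsHamiltonianTrajectory Φ γ) (s : ℝ) : ‖(γ s).2‖ ≤ √(2 * energy Φ (γ 0)) := by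
  refine Real.le_sqrt_of_sq_le ?_
  rw [← h.energy_eq hΦ s, energy]
  linarith [h0 (γ s).1]

theorem IsHamiltonianTrajectory.norm_fst_sub_le (hΦ : ContDiff ℝ 2 Φ) (h0 : ∀ q, 0 ≤ Φ q)
    (h : IsHamiltonianTrajectory Φ γ) (s : ℝ) :
    ‖(γ s).1 - (γ 0).1‖ ≤ |s| * √(2 * energy Φ (γ 0)) := by
  have := convex_univ.norm_image_sub_le_of_norm_hasDerivWithin_le (f := fun t => (γ t).1)
    (fun t _ => (h.hasDerivAt_fst t).hasDerivWithinAt) (fun t _ => h.norm_snd_le hΦ h0 t)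
    (mem_univ 0) (mem_univ s)
  simpa [mul_comm] using this

theorem IsHamiltonianTrajectory.comp_add (h : IsHamiltonianTrajectory Φ γ) (t : ℝ) :
    IsHamiltonianTrajectory Φ fun s => γ (s + t) :=
  fun s => (h (s + t)).comp_add_const s t

end Trajectory

section Flow

variable {Φ : EuclideanSpace ℝ (Fin D) → ℝ}

/-- Global existence. The truncated potentials have global solutions; conservation of their
energies bounds the positions reached up to a given time, independently of the truncation. -/
theorem exists_isHamiltonianTrajectory (hΦ : ContDiff ℝ 2 Φ) (h0 : ∀ q, 0 ≤ Φ q) (z : Phase D) :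
    ∃ γ : ℝ → Phase D, γ 0 = z ∧ IsHamiltonianTrajectory Φ γ := by
  refine exists_forall_hasDerivAt_of_forall_Ioo (contDiff_hamiltonianField hΦ) fun a => ?_
  obtain ⟨Ψ, hΨ, hΨ0, hle, ⟨K, hK⟩, hgrad⟩ :=
    exists_cutoff hΦ h0 (‖z.1‖ + |a| * √(2 * energy Φ z) + 1)
  obtain ⟨γ, hγ0, hγ⟩ := exists_forall_hasDerivAt_of_lipschitzWith
    (contDiff_hamiltonianField hΨ) (lipschitzWith_hamiltonianField hK) z
  have hγ' : IsHamiltonianTrajectory Ψ γ := hγ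
  refine ⟨γ, hγ0, fun t ht => (hγ t).congr_deriv ?_⟩
  have h1 := hγ'.norm_fst_sub_le hΨ hΨ0 t
  rw [hγ0] at h1
  have h2 : energy Ψ z ≤ energy Φ z := by simpa [energy] using hle z.1
  have h3 : |t| ≤ |a| := (abs_lt.2 ht).le.trans (le_abs_self a)
  have h4 : |t| * √(2 * energy Ψ z) ≤ |a| * √(2 * energy Φ z) := by gcongr
  have h5 : ‖(γ t).1‖ ≤ ‖(γ t).1 - z.1‖ + ‖z.1‖ := by simpa using norm_add_le ((γ t).1 - z.1) z.1
  simp only [hamiltonianField]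
  rw [hgrad _ (by linarith)]

theorem hamiltonianFlow_zero_and_isHamiltonianTrajectory (hΦ : ContDiff ℝ 2 Φ)
    (h0 : ∀ q, 0 ≤ Φ q) (z : Phase D) :
    hamiltonianFlow Φ 0 z = z ∧ IsHamiltonianTrajectory Φ fun s => hamiltonianFlow Φ s z := by
  have h := exists_isHamiltonianTrajectory hΦ h0 z
  have hs : ∀ s, hamiltonianFlow Φ s z = h.choose s := fun s => dif_pos h
  simp only [hs]
  exact h.choose_spec

theorem hamiltonianFlow_zero (hΦ : ContDiff ℝ 2 Φ) (h0 : ∀ q, 0 ≤ Φ q) (z : Phase D) :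
    hamiltonianFlow Φ 0 z = z :=
  (hamiltonianFlow_zero_and_isHamiltonianTrajectory hΦ h0 z).1

theorem isHamiltonianTrajectory_hamiltonianFlow (hΦ : ContDiff ℝ 2 Φ)
    (h0 : ∀ q, 0 ≤ Φ q) (z : Phase D) :
    IsHamiltonianTrajectory Φ fun s => hamiltonianFlow Φ s z :=
  (hamiltonianFlow_zero_and_isHamiltonianTrajectory hΦ h0 z).2

/-- A solution up to time `T` is given by the flow: both stay in a ball, on which the field is
Lipschitz. -/
theorem eq_hamiltonianFlow (hΦ : ContDiff ℝ 2 Φ) (h0 : ∀ q, 0 ≤ Φ q) {γ : ℝ → Phase D} {T : ℝ}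
    (h : ∀ t, |t| ≤ T → HasDerivAt γ (hamiltonianField Φ (γ t)) t) {t : ℝ} (ht : |t| ≤ T) :
    γ t = hamiltonianFlow Φ t (γ 0) := by
  have hflow := isHamiltonianTrajectory_hamiltonianFlow hΦ h0 (γ 0)
  have hI : ∀ {s : ℝ}, |s| ≤ T ↔ s ∈ Icc (-T) T := abs_le
  obtain ⟨r₁, hr₁⟩ := (isCompact_Icc.image_of_continuousOn (s := Icc (-T) T) (f := γ)
    fun s hs => (h s (hI.2 hs)).continuousAt.continuousWithinAt).isBounded.subset_closedBall 0
  obtain ⟨r₂, hr₂⟩ := (isCompact_Icc.image_of_continuousOn (s := Icc (-T) T)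
    (f := fun s => hamiltonianFlow Φ s (γ 0))
    fun s _ => (hflow s).continuousAt.continuousWithinAt).isBounded.subset_closedBall 0
  obtain ⟨K, hK⟩ := exists_lipschitzOnWith_hamiltonianField hΦ (max r₁ r₂)
  have := dist_le_mul_exp_of_mem hK h
    (fun s hs => closedBall_subset_closedBall (le_max_left r₁ r₂)
      (hr₁ (mem_image_of_mem _ (hI.1 hs))))
    (fun s _ => hflow s)
    (fun s hs => closedBall_subset_closedBall (le_max_right r₁ r₂)
      (hr₂ (mem_image_of_mem _ (hI.1 hs)))) ht
  rw [hamiltonianFlow_zero hΦ h0, dist_self, zero_mul] at this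
  exact dist_le_zero.1 this

theorem hamiltonianFlow_add (hΦ : ContDiff ℝ 2 Φ) (h0 : ∀ q, 0 ≤ Φ q) (s t : ℝ) (z : Phase D) :
    hamiltonianFlow Φ (s + t) z = hamiltonianFlow Φ s (hamiltonianFlow Φ t z) := by
  have := eq_hamiltonianFlow hΦ h0
    (fun u _ => (isHamiltonianTrajectory_hamiltonianFlow hΦ h0 z).comp_add t u) (le_refl |s|)
  simpa using this

theorem hamiltonianFlow_hamiltonianFlow_neg (hΦ : ContDiff ℝ 2 Φ) (h0 : ∀ q, 0 ≤ Φ q) (s : ℝ)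
    (z : Phase D) : hamiltonianFlow Φ s (hamiltonianFlow Φ (-s) z) = z := by
  rw [← hamiltonianFlow_add hΦ h0, add_neg_cancel, hamiltonianFlow_zero hΦ h0]

/-- The flow maps bounded sets to bounded sets, uniformly over bounded times. -/
theorem exists_norm_hamiltonianFlow_le (hΦ : ContDiff ℝ 2 Φ) (h0 : ∀ q, 0 ≤ Φ q) (T r : ℝ) :
    ∃ R : ℝ, ∀ s, |s| ≤ T → ∀ z, ‖z‖ ≤ r → ‖hamiltonianFlow Φ s z‖ ≤ R := by
  have hcont : Continuous (energy Φ) := by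
    have := hΦ.continuous
    unfold energy
    fun_prop
  obtain ⟨M, hM⟩ := (isCompact_closedBall (0 : Phase D) r).bddAbove_image hcont.continuousOn
  refine ⟨max (r + T * √(2 * M)) (√(2 * M)), fun s hs z hz => ?_⟩
  have hE : energy Φ z ≤ M := hM (mem_image_of_mem _ (by simpa using hz))
  have htraj := isHamiltonianTrajectory_hamiltonianFlow hΦ h0 z
  have h1 := htraj.norm_fst_sub_le hΦ h0 s
  have h2 := htraj.norm_snd_le hΦ h0 s
  simp only [hamiltonianFlow_zero hΦ h0] at h1 h2
  have h3 : √(2 * energy Φ z) ≤ √(2 * M) := by gcongr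
  have h4 : |s| * √(2 * energy Φ z) ≤ T * √(2 * M) :=
    mul_le_mul hs h3 (Real.sqrt_nonneg _) ((abs_nonneg s).trans hs)
  have h5 : ‖(hamiltonianFlow Φ s z).1‖ ≤ ‖(hamiltonianFlow Φ s z).1 - z.1‖ + ‖z.1‖ := by
    simpa using norm_add_le ((hamiltonianFlow Φ s z).1 - z.1) z.1
  have h6 : ‖z.1‖ ≤ r := (norm_fst_le z).trans hz
  exact max_le_max (by linarith) (h2.trans h3)

/-- The flow is Lipschitz on bounded sets, uniformly over bounded times. -/
theorem exists_lipschitzOnWith_hamiltonianFlow (hΦ : ContDiff ℝ 2 Φ) (h0 : ∀ q, 0 ≤ Φ q)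
    (T r : ℝ) : ∃ K : ℝ≥0, ∀ s, |s| ≤ T →
      LipschitzOnWith K (hamiltonianFlow Φ s) (closedBall 0 r) := by
  obtain ⟨R, hR⟩ := exists_norm_hamiltonianFlow_le hΦ h0 T r
  obtain ⟨K, hK⟩ := exists_lipschitzOnWith_hamiltonianField hΦ R
  refine ⟨(Real.exp (K * T)).toNNReal, fun s hs => ?_⟩
  refine LipschitzOnWith.of_dist_le_mul fun z hz w hw => ?_
  have hmem : ∀ z ∈ closedBall (0 : Phase D) r, ∀ t, |t| ≤ T →
      hamiltonianFlow Φ t z ∈ closedBall 0 R := fun z hz t ht => by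
    simpa using hR t ht z (by simpa using hz)
  have := dist_le_mul_exp_of_mem hK
    (fun t _ => isHamiltonianTrajectory_hamiltonianFlow hΦ h0 z t) (hmem z hz)
    (fun t _ => isHamiltonianTrajectory_hamiltonianFlow hΦ h0 w t) (hmem w hw) hs
  simp only [hamiltonianFlow_zero hΦ h0] at this
  refine this.trans ?_
  rw [mul_comm, Real.coe_toNNReal _ (Real.exp_pos _).le]
  gcongr

theorem continuous_hamiltonianFlow (hΦ : ContDiff ℝ 2 Φ) (h0 : ∀ q, 0 ≤ Φ q) :
    Continuous fun x : ℝ × Phase D => hamiltonianFlow Φ x.1 x.2 := by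
  refine continuous_iff_continuousAt.2 fun x => ?_
  obtain ⟨K, hK⟩ := exists_lipschitzOnWith_hamiltonianFlow hΦ h0 (|x.1| + 1) (‖x.2‖ + 1)
  have hc := continuousOn_prod_of_continuousOn_lipschitzOnWith'
    (fun y : ℝ × Phase D => hamiltonianFlow Φ y.1 y.2) (s := {s | |s| ≤ |x.1| + 1})
    (t := closedBall 0 (‖x.2‖ + 1)) K (fun s hs => hK s hs)
    (fun z _ s _ => (isHamiltonianTrajectory_hamiltonianFlow hΦ h0 z s).continuousAt
      |>.continuousWithinAt)
  refine hc.continuousAt (prod_mem_nhds ?_ ?_)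
  · exact mem_of_superset (isOpen_lt continuous_abs continuous_const |>.mem_nhds
      (show |x.1| < |x.1| + 1 by linarith)) fun s (hs : |s| < _) => hs.le
  · exact mem_of_superset (isOpen_lt continuous_norm continuous_const |>.mem_nhds
      (show ‖x.2‖ < ‖x.2‖ + 1 by linarith)) fun s hs => by simpa using le_of_lt hs

end Flow

/-! ### Steering the position in a short time -/

/-- Over times short compared with the Lipschitz constant of the gradient, the dependence of the
position on the initial momentum is a small perturbation of free motion. -/
theorem norm_fst_hamiltonianFlow_sub_sub_le {Ψ : EuclideanSpace ℝ (Fin D) → ℝ}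
    (hΨ : ContDiff ℝ 2 Ψ) (h0 : ∀ q, 0 ≤ Ψ q) {K : ℝ≥0} (hK : LipschitzWith K (gradient Ψ))
    {s : ℝ} (hs0 : 0 ≤ s) (hs : (1 + K) * s ≤ 1 / 8) (q p p' : EuclideanSpace ℝ (Fin D)) :
    ‖(hamiltonianFlow Ψ s (q, p)).1 - (hamiltonianFlow Ψ s (q, p')).1 - s • (p - p')‖
      ≤ s / 2 * ‖p - p'‖ := by
  set γ := fun t => hamiltonianFlow Ψ t (q, p) with hγdef
  set γ' := fun t => hamiltonianFlow Ψ t (q, p') with hγ'def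
  have hγ : IsHamiltonianTrajectory Ψ γ := isHamiltonianTrajectory_hamiltonianFlow hΨ h0 _
  have hγ' : IsHamiltonianTrajectory Ψ γ' := isHamiltonianTrajectory_hamiltonianFlow hΨ h0 _
  have hγ0 : γ 0 = (q, p) := hamiltonianFlow_zero hΨ h0 _
  have hγ'0 : γ' 0 = (q, p') := hamiltonianFlow_zero hΨ h0 _
  have hKs : (K : ℝ) * s ≤ 1 / 8 := by nlinarith
  have hexp : Real.exp 1 ≤ 3 := by linarith [Real.exp_one_lt_d9]
  -- The two solutions stay within three times their initial distance.
  have hdist : ∀ t ∈ Icc 0 s, ‖(γ t).1 - (γ' t).1‖ ≤ 3 * ‖p - p'‖ := by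
    intro t ht
    have h1 := dist_le_mul_exp_of_mem (lipschitzWith_hamiltonianField hK).lipschitzOnWith
      (fun u _ => hγ u) (fun u _ => mem_univ _) (fun u _ => hγ' u) (fun u _ => mem_univ _)
      (le_refl |t|)
    have h2 : dist (γ 0) (γ' 0) = ‖p - p'‖ := by
      rw [hγ0, hγ'0, dist_prod_same_left, dist_eq_norm]
    have h3 : ((max 1 K : ℝ≥0) : ℝ) * |t| ≤ 1 := by
      rw [abs_of_nonneg ht.1]
      have h4 : ((max 1 K : ℝ≥0) : ℝ) ≤ 1 + K := by
        rw [NNReal.coe_max, NNReal.coe_one]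
        exact max_le (by simp) (by simp)
      calc ((max 1 K : ℝ≥0) : ℝ) * t ≤ (1 + K) * s := by
            gcongr
            exacts [ht.1, ht.2]
        _ ≤ 1 := by linarith
    have h5 : Real.exp (((max 1 K : ℝ≥0) : ℝ) * |t|) ≤ 3 := (Real.exp_le_exp.2 h3).trans hexp
    have h6 : ‖(γ t).1 - (γ' t).1‖ ≤ dist (γ t) (γ' t) := by
      rw [dist_eq_norm]
      exact norm_fst_le (γ t - γ' t)
    rw [h2] at h1
    calc ‖(γ t).1 - (γ' t).1‖ ≤ ‖p - p'‖ * Real.exp (((max 1 K : ℝ≥0) : ℝ) * |t|) := h6.trans h1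
      _ ≤ ‖p - p'‖ * 3 := by gcongr
      _ = 3 * ‖p - p'‖ := mul_comm _ _
  -- Hence the difference of the momenta is nearly constant.
  have hmom : ∀ t ∈ Icc 0 s, ‖(γ t).2 - (γ' t).2 - (p - p')‖ ≤ 1 / 2 * ‖p - p'‖ := by
    intro t ht
    have := (convex_Icc 0 s).norm_image_sub_le_of_norm_hasDerivWithin_le
      (f := fun u => (γ u).2 - (γ' u).2) (C := K * (3 * ‖p - p'‖))
      (fun u _ => ((hγ.hasDerivAt_snd u).sub (hγ'.hasDerivAt_snd u)).hasDerivWithinAt)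
      (fun u hu => by
        rw [neg_sub_neg, norm_sub_rev]
        exact (hK.norm_sub_le _ _).trans (by gcongr; exact hdist u hu))
      (left_mem_Icc.2 hs0) ht
    simp only [hγ0, hγ'0, sub_zero, Real.norm_eq_abs, abs_of_nonneg ht.1] at this
    refine this.trans ?_
    calc K * (3 * ‖p - p'‖) * t ≤ K * (3 * ‖p - p'‖) * s := by
          gcongr
          exact ht.2
      _ = 3 * (K * s) * ‖p - p'‖ := by ring
      _ ≤ 1 / 2 * ‖p - p'‖ := by
          gcongr
          linarith
  have := (convex_Icc 0 s).norm_image_sub_le_of_norm_hasDerivWithin_le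
    (f := fun u => (γ u).1 - (γ' u).1 - u • (p - p')) (C := 1 / 2 * ‖p - p'‖)
    (fun u _ => (((hγ.hasDerivAt_fst u).sub (hγ'.hasDerivAt_fst u)).sub
      ((hasDerivAt_id u).smul_const (p - p'))).hasDerivWithinAt)
    (fun u hu => by simpa using hmom u hu) (left_mem_Icc.2 hs0) (right_mem_Icc.2 hs0)
  simp only [hγ0, hγ'0, sub_self, zero_smul, sub_zero, Real.norm_eq_abs, abs_of_nonneg hs0] at this
  exact this.trans_eq (by ring)

/-- Any two positions of a ball are joined by a solution in any given time of `[h, 2h]`, if `h` is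
small, with an initial momentum that is bounded uniformly. Momenta of order `1 / h` are needed, but
over a time of order `h` they move the position by a bounded amount, so the truncation radius and
with it the Lipschitz constant of the gradient can be fixed before `h`. -/
theorem exists_momentum_fst_hamiltonianFlow_eq {Φ : EuclideanSpace ℝ (Fin D) → ℝ}
    (hΦ : ContDiff ℝ 2 Φ) (h0 : ∀ q, 0 ≤ Φ q) (r : ℝ) :
    ∃ h M : ℝ, 0 < h ∧ h ≤ 1 ∧ ∀ s ∈ Icc h (2 * h), ∀ q q' : EuclideanSpace ℝ (Fin D),
      ‖q‖ ≤ r → ‖q'‖ ≤ r → ∃ p, ‖p‖ ≤ M ∧ (hamiltonianFlow Φ s (q, p)).1 = q' := by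
  obtain ⟨m, hm⟩ := (isCompact_closedBall (0 : EuclideanSpace ℝ (Fin D)) r).bddAbove_image
    hΦ.continuous.continuousOn
  set C := √(2 * m) with hC
  obtain ⟨Ψ, hΨ, hΨ0, hle, ⟨K, hK⟩, hgrad⟩ := exists_cutoff hΦ h0 (5 * r + 3 * C + 1)
  have hLpos : (0 : ℝ) < 1 + K := by positivity
  have hhpos : (0 : ℝ) < 1 / (16 * (1 + K)) := by positivity
  have hh1 : (1 : ℝ) / (16 * (1 + K)) ≤ 1 := by
    rw [div_le_one (by positivity)]
    linarith [K.2]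
  refine ⟨1 / (16 * (1 + K)), 4 * r / (1 / (16 * (1 + K))) + 2 * C, hhpos, hh1,
    fun s hs q q' hq hq' => ?_⟩
  have hspos : 0 < s := hhpos.trans_le hs.1
  have hLs : (1 + K) * s ≤ 1 / 8 := by
    calc (1 + K) * s ≤ (1 + K) * (2 * (1 / (16 * (1 + K)))) := by
          gcongr
          exact hs.2
      _ = 1 / 8 := by field_simp; norm_num
  have hs1 : s ≤ 1 := by nlinarith [K.2]
  have hr : 0 ≤ r := (norm_nonneg q).trans hq
  have hC0 : 0 ≤ C := Real.sqrt_nonneg _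
  have hΨq : Ψ q ≤ m := (hle q).trans (hm (mem_image_of_mem _ (by simpa using hq)))
  have hm0 : 0 ≤ m := (hΨ0 q).trans hΨq
  have hC2 : C ^ 2 = 2 * m := Real.sq_sqrt (by positivity)
  have hener : ∀ p, √(2 * energy Ψ (q, p)) ≤ ‖p‖ + C := by
    intro p
    refine Real.sqrt_le_iff.2 ⟨by positivity, ?_⟩
    have : 0 ≤ ‖p‖ * C := by positivity
    simp only [energy]
    nlinarith
  have hpert := norm_fst_hamiltonianFlow_sub_sub_le hΨ hΨ0 hK hspos.le hLs q
  have hpos : ∀ p t, ‖(hamiltonianFlow Ψ t (q, p)).1 - q‖ ≤ |t| * (‖p‖ + C) := by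
    intro p t
    have := (isHamiltonianTrajectory_hamiltonianFlow hΨ hΨ0 (q, p)).norm_fst_sub_le hΨ hΨ0 t
    simp only [hamiltonianFlow_zero hΨ hΨ0] at this
    exact this.trans (by gcongr; exact hener p)
  -- The momentum is the fixed point of a simplified Newton iteration.
  have hcontr : ContractingWith (1 / 2) fun p : EuclideanSpace ℝ (Fin D) =>
      p - s⁻¹ • ((hamiltonianFlow Ψ s (q, p)).1 - q') := by
    refine ⟨by rw [← NNReal.coe_lt_coe]; norm_num, LipschitzWith.of_dist_le_mul fun p p' => ?_⟩
    have heq : p - s⁻¹ • ((hamiltonianFlow Ψ s (q, p)).1 - q')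
        - (p' - s⁻¹ • ((hamiltonianFlow Ψ s (q, p')).1 - q'))
        = -(s⁻¹ • ((hamiltonianFlow Ψ s (q, p)).1 - (hamiltonianFlow Ψ s (q, p')).1
          - s • (p - p'))) := by
      rw [smul_sub s⁻¹ _ (s • (p - p')), smul_smul, inv_mul_cancel₀ hspos.ne', one_smul]
      module
    rw [dist_eq_norm, dist_eq_norm, heq, norm_neg, norm_smul, Real.norm_eq_abs,
      abs_of_pos (inv_pos.2 hspos)]
    calc s⁻¹ * _ ≤ s⁻¹ * (s / 2 * ‖p - p'‖) := by
          gcongr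
          exact hpert p p'
      _ = ((1 / 2 : ℝ≥0) : ℝ) * ‖p - p'‖ := by
          push_cast
          field_simp
  set p := hcontr.fixedPoint with hp
  have hpq : (hamiltonianFlow Ψ s (q, p)).1 = q' := by
    have : p - s⁻¹ • ((hamiltonianFlow Ψ s (q, p)).1 - q') = p := hcontr.fixedPoint_isFixedPt
    rw [sub_eq_self, smul_eq_zero, sub_eq_zero] at this
    exact this.resolve_left (inv_ne_zero hspos.ne')
  have hsp : s * ‖p‖ ≤ 4 * r + 2 * s * C := by
    have h1 := hpert p 0
    have h2 := hpos 0 s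
    rw [hpq, sub_zero] at h1
    rw [norm_zero, zero_add, abs_of_pos hspos] at h2
    have h3 : ‖s • p‖ ≤ ‖q' - (hamiltonianFlow Ψ s (q, 0)).1 - s • p‖
        + (‖q'‖ + (‖(hamiltonianFlow Ψ s (q, 0)).1 - q‖ + ‖q‖)) := by
      calc ‖s • p‖ = ‖-(q' - (hamiltonianFlow Ψ s (q, 0)).1 - s • p)
            + (q' + (-((hamiltonianFlow Ψ s (q, 0)).1 - q) + -q))‖ := by
              congr 1
              abel
        _ ≤ _ := by
              refine (norm_add_le _ _).trans ?_
              rw [norm_neg]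
              gcongr
              refine (norm_add_le _ _).trans ?_
              gcongr
              refine (norm_add_le _ _).trans ?_
              rw [norm_neg, norm_neg]
    rw [norm_smul, Real.norm_eq_abs, abs_of_pos hspos] at h3
    linarith
  refine ⟨p, ?_, ?_⟩
  · have h1 : ‖p‖ ≤ 4 * r / s + 2 * C := by
      rw [← mul_le_mul_iff_right₀ hspos]
      calc s * ‖p‖ ≤ 4 * r + 2 * s * C := hsp
        _ = s * (4 * r / s + 2 * C) := by field_simp
    refine h1.trans ?_
    gcongr
    exact hs.1
  · have hconf : ∀ t, |t| ≤ s → HasDerivAt (fun t => hamiltonianFlow Ψ t (q, p))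
        (hamiltonianField Φ (hamiltonianFlow Ψ t (q, p))) t := by
      intro t ht
      refine (isHamiltonianTrajectory_hamiltonianFlow hΨ hΨ0 (q, p) t).congr_deriv ?_
      have h1 := hpos p t
      have h2 : |t| * (‖p‖ + C) ≤ s * (‖p‖ + C) := by gcongr
      have h3 : ‖(hamiltonianFlow Ψ t (q, p)).1‖
          ≤ ‖(hamiltonianFlow Ψ t (q, p)).1 - q‖ + ‖q‖ := by
        simpa using norm_add_le ((hamiltonianFlow Ψ t (q, p)).1 - q) q
      have h4 : s * C ≤ C := by nlinarith
      simp only [hamiltonianField]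
      rw [hgrad _ (by linarith)]
    have := eq_hamiltonianFlow hΦ h0 hconf (abs_of_pos hspos).le
    simp only [hamiltonianFlow_zero hΨ hΨ0] at this
    rw [← this, hpq]

/-! ### Lower bounds for measures and their images -/

/-- A Lipschitz map increases Lebesgue measure by at most a constant factor, as it does so for the
Hausdorff measure of the full dimension. -/
theorem volume_image_le_of_lipschitzOnWith {E : Type*} [NormedAddCommGroup E] [NormedSpace ℝ E]
    [FiniteDimensional ℝ E] [MeasureSpace E] [BorelSpace E]
    [(volume : Measure E).IsAddHaarMeasure] {f : E → E} {S : Set E} {L : ℝ≥0}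
    (hf : LipschitzOnWith L f S) :
    volume (f '' S) ≤ (L : ℝ≥0∞) ^ Module.finrank ℝ E * volume S := by
  have h := hf.hausdorffMeasure_image_le (d := Module.finrank ℝ E) (Nat.cast_nonneg _)
  rw [ENNReal.rpow_natCast] at h
  rw [Measure.isAddLeftInvariant_eq_smul (volume : Measure E)
    (Measure.hausdorffMeasure (Module.finrank ℝ E) : Measure E)]
  simp only [Measure.smul_apply, ENNReal.smul_def, smul_eq_mul]
  rw [mul_left_comm]
  gcongr

/-- If a measure dominates a multiple of Lebesgue measure on `S`, then its image under a map that
is Lipschitz on `S` dominates a multiple of Lebesgue measure on the image of `S`. Neither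
injectivity nor differentiability of the map is needed. -/
theorem smul_restrict_le_map_of_lipschitzOnWith {E : Type*} [NormedAddCommGroup E]
    [NormedSpace ℝ E] [FiniteDimensional ℝ E] [MeasureSpace E] [BorelSpace E]
    [(volume : Measure E).IsAddHaarMeasure] {f : E → E} {S K : Set E} {L : ℝ≥0} {c : ℝ≥0∞}
    {μ : Measure E} (hμ : c • volume.restrict S ≤ μ) (hfm : Measurable f)
    (hf : LipschitzOnWith L f S) (hK : K ⊆ f '' S) :
    (c / (L + 1 : ℝ≥0∞) ^ Module.finrank ℝ E) • volume.restrict K ≤ μ.map f := by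
  refine Measure.le_iff.2 fun A hA => ?_
  have hL : LipschitzOnWith (L + 1) f (f ⁻¹' A ∩ S) :=
    (hf.mono inter_subset_right).weaken (by simp)
  have h1 : volume (A ∩ K) ≤ (L + 1 : ℝ≥0∞) ^ Module.finrank ℝ E * volume (f ⁻¹' A ∩ S) := by
    refine (measure_mono fun y hy => ?_).trans
      ((volume_image_le_of_lipschitzOnWith hL).trans_eq (by push_cast; rfl))
    obtain ⟨x, hx, rfl⟩ := hK hy.2
    exact ⟨x, ⟨hy.1, hx⟩, rfl⟩
  have h2 : c * volume (f ⁻¹' A ∩ S) ≤ μ (f ⁻¹' A) := by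
    have := hμ (f ⁻¹' A)
    rwa [Measure.smul_apply, Measure.restrict_apply (hfm hA), smul_eq_mul] at this
  rw [Measure.map_apply hfm hA, Measure.smul_apply, Measure.restrict_apply hA, smul_eq_mul]
  have h0 : (L + 1 : ℝ≥0∞) ^ Module.finrank ℝ E ≠ 0 := pow_ne_zero _ (by simp)
  have htop : (L + 1 : ℝ≥0∞) ^ Module.finrank ℝ E ≠ ⊤ := by finiteness
  refine le_trans ?_ h2
  calc c / (L + 1 : ℝ≥0∞) ^ Module.finrank ℝ E * volume (A ∩ K)
      ≤ c / (L + 1 : ℝ≥0∞) ^ Module.finrank ℝ E *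
        ((L + 1 : ℝ≥0∞) ^ Module.finrank ℝ E * volume (f ⁻¹' A ∩ S)) := by gcongr
    _ = c * volume (f ⁻¹' A ∩ S) := by
        rw [← mul_assoc, ENNReal.div_mul_cancel h0 htop]

theorem exists_mul_volume_le_gaussianReal (ρ : ℝ) :
    ∃ c : ℝ≥0∞, c ≠ 0 ∧ ∀ S ⊆ Icc (-ρ) ρ, c * volume S ≤ gaussianReal 0 1 S := by
  refine ⟨gaussianPDF 0 1 ρ, by simp [gaussianPDF, gaussianPDFReal_pos], fun S hS => ?_⟩
  rw [gaussianReal_of_var_ne_zero 0 one_ne_zero, withDensity_apply' _ S]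
  rw [← setLIntegral_const]
  refine setLIntegral_mono (measurable_gaussianPDF 0 1) fun x hx => ?_
  have hx2 : x ^ 2 ≤ ρ ^ 2 := sq_le_sq' (hS hx).1 (hS hx).2
  refine ENNReal.ofReal_le_ofReal ?_
  simp only [gaussianPDFReal_def, sub_zero]
  gcongr

/-- The standard Gaussian density is bounded below on balls. -/
theorem exists_smul_restrict_le_stdGaussian (ρ : ℝ) :
    ∃ c : ℝ≥0∞, c ≠ 0 ∧ c • volume.restrict (closedBall 0 ρ) ≤
      stdGaussian (EuclideanSpace ℝ (Fin D)) := by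
  obtain ⟨c, hc, hle⟩ := exists_mul_volume_le_gaussianReal ρ
  refine ⟨c ^ D, pow_ne_zero _ hc, ?_⟩
  let I : Set (Fin D → ℝ) := univ.pi fun _ => Icc (-ρ) ρ
  have hI : MeasurableSet I := MeasurableSet.univ_pi fun _ => measurableSet_Icc
  have hpi : c ^ D • volume.restrict I ≤ Measure.pi fun _ : Fin D => gaussianReal 0 1 := by
    have houter : (c ^ D • volume.restrict I).toOuterMeasure ≤
        OuterMeasure.pi fun _ : Fin D => (gaussianReal 0 1).toOuterMeasure := by
      refine OuterMeasure.le_pi.2 fun s _ => ?_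
      change (c ^ D • volume.restrict I) (univ.pi s) ≤ ∏ i, gaussianReal 0 1 (s i)
      rw [Measure.smul_apply, Measure.restrict_apply' hI, smul_eq_mul, ← pi_inter_distrib,
        volume_pi, Measure.pi_pi]
      calc c ^ D * ∏ i : Fin D, volume (s i ∩ Icc (-ρ) ρ)
          = ∏ i : Fin D, c * volume (s i ∩ Icc (-ρ) ρ) := by
            rw [Finset.prod_mul_distrib]
            simp
        _ ≤ ∏ i, gaussianReal 0 1 (s i) := Finset.prod_le_prod' fun i _ =>
            (hle _ inter_subset_right).trans (measure_mono inter_subset_left)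
    refine Measure.le_iff.2 fun s hs => ?_
    rw [Measure.pi, toMeasure_apply _ _ hs]
    exact houter s
  have hvp := PiLp.volume_preserving_toLp (Fin D)
  refine Measure.le_iff.2 fun A hA => ?_
  rw [← map_pi_eq_stdGaussian, Measure.map_apply hvp.measurable hA, Measure.smul_apply,
    Measure.restrict_apply hA]
  refine le_trans ?_ (hpi _)
  rw [Measure.smul_apply, Measure.restrict_apply (hvp.measurable hA),
    ← hvp.measure_preimage (hA.inter measurableSet_closedBall).nullMeasurableSet]
  gcongr
  refine inter_subset_inter_right _ fun x hx i _ => ?_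
  have h1 : ‖x i‖ ≤ ‖WithLp.toLp 2 x‖ := PiLp.norm_apply_le (WithLp.toLp 2 x) i
  have h2 : ‖WithLp.toLp 2 x‖ ≤ ρ := mem_closedBall_zero_iff.1 hx
  exact abs_le.1 (h1.trans h2)

theorem exists_smul_restrict_le_prod_stdGaussian (ρ : ℝ) :
    ∃ c : ℝ≥0∞, c ≠ 0 ∧ c • volume.restrict (closedBall (0 : Phase D) ρ) ≤
      (stdGaussian (EuclideanSpace ℝ (Fin D))).prod (stdGaussian (EuclideanSpace ℝ (Fin D))) := by
  obtain ⟨c, hc, hle⟩ := exists_smul_restrict_le_stdGaussian (D := D) ρ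
  refine ⟨c * c, mul_ne_zero hc hc, ?_⟩
  refine le_trans (le_of_eq ?_) (Measure.prod_mono hle hle)
  rw [Measure.prod_smul_left, Measure.prod_smul_right, Measure.prod_restrict, closedBall_prod_same,
    smul_smul]
  rfl

theorem expMeasure_ne_zero {r : ℝ} (hr : 0 < r) {S : Set ℝ} (hS : S ⊆ Ioi 0)
    (hpos : volume S ≠ 0) : expMeasure r S ≠ 0 := by
  have hm : Measurable (gammaPDF 1 r) := (measurable_gammaPDFReal 1 r).ennreal_ofReal
  rw [expMeasure, gammaMeasure, Ne, withDensity_apply_eq_zero hm]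
  rwa [inter_eq_right.2 fun x hx => ?_]
  exact (ENNReal.ofReal_pos.2 (gammaPDFReal_pos one_pos hr (hS hx))).ne'

/-! ### The state after two momentum randomizations -/

/-- The state at time `t` if there are exactly two momentum randomizations before it: `σ` is the
pair of the waiting times before them, `ξ` the pair of the Gaussian vectors used in them. -/
def twoJumpState (phi : ℝ) (Φ : EuclideanSpace ℝ (Fin D) → ℝ) (t : ℝ) (z : Phase D) (σ : ℝ × ℝ)
    (ξ : Phase D) : Phase D :=
  hamiltonianFlow Φ (t - (σ.1 + σ.2)) (momentumRandomization phi
    (hamiltonianFlow Φ σ.2 (momentumRandomization phi (hamiltonianFlow Φ σ.1 z) ξ.1)) ξ.2)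

theorem norm_momentumRandomization_le (phi : ℝ) (z : Phase D) (ξ : EuclideanSpace ℝ (Fin D)) :
    ‖momentumRandomization phi z ξ‖ ≤ ‖z‖ + ‖ξ‖ := by
  refine max_le ((norm_fst_le z).trans (by simp)) ?_
  refine (norm_add_le _ _).trans ?_
  rw [norm_smul, norm_smul]
  refine add_le_add ?_ (mul_le_of_le_one_left (norm_nonneg _) (Real.abs_sin_le_one _))
  exact (mul_le_of_le_one_left (norm_nonneg _) (Real.abs_cos_le_one _)).trans (norm_snd_le z)

theorem lipschitzWith_momentumRandomization (phi : ℝ) :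
    LipschitzWith 2 fun x : Phase D × EuclideanSpace ℝ (Fin D) =>
      momentumRandomization phi x.1 x.2 := by
  refine LipschitzWith.of_dist_le_mul fun x y => ?_
  have h : momentumRandomization phi x.1 x.2 - momentumRandomization phi y.1 y.2
      = momentumRandomization phi (x.1 - y.1) (x.2 - y.2) := by
    ext1
    · rfl
    · simp only [momentumRandomization, Prod.snd_sub]
      module
  rw [dist_eq_norm, dist_eq_norm, h]
  have h1 := norm_momentumRandomization_le phi (x.1 - y.1) (x.2 - y.2)
  have h2 := norm_fst_le (x - y)
  have h3 := norm_snd_le (x - y)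
  simp only [Prod.fst_sub, Prod.snd_sub] at h2 h3
  push_cast
  linarith

theorem momentumRandomization_eq {phi : ℝ} (hs : Real.sin phi ≠ 0) (z : Phase D)
    (p : EuclideanSpace ℝ (Fin D)) :
    momentumRandomization phi z ((Real.sin phi)⁻¹ • (p - Real.cos phi • z.2)) = (z.1, p) := by
  simp only [momentumRandomization, smul_smul, mul_inv_cancel₀ hs, one_smul]
  rw [add_sub_cancel]

theorem norm_inv_sin_smul_sub_le {phi : ℝ} (hs : 0 < Real.sin phi)
    (p p' : EuclideanSpace ℝ (Fin D)) :
    ‖(Real.sin phi)⁻¹ • (p - Real.cos phi • p')‖ ≤ (Real.sin phi)⁻¹ * (‖p‖ + ‖p'‖) := by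
  rw [norm_smul, Real.norm_of_nonneg (inv_pos.2 hs).le]
  gcongr
  refine (norm_sub_le _ _).trans ?_
  gcongr
  rw [norm_smul]
  exact mul_le_of_le_one_left (norm_nonneg _) (Real.abs_cos_le_one _)

/-- With waiting times in `[h, 2h]` and `t = 4h`, the Gaussian vectors of a fixed ball steer every
point of a bounded set to every other point of it. The target is first pulled back by the final
stretch of the flow; the first randomization then sets the momentum that leads to the required
position, the second one the required momentum. -/
theorem exists_lipschitzOnWith_twoJumpState {phi : ℝ} (hsin : 0 < Real.sin phi)
    {Φ : EuclideanSpace ℝ (Fin D) → ℝ} (hΦ : ContDiff ℝ 2 Φ) (h0 : ∀ q, 0 ≤ Φ q)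
    {K : Set (Phase D)} (hK : Bornology.IsBounded K) :
    ∃ (h ρ : ℝ) (L : ℝ≥0), 0 < h ∧ ∀ z ∈ K, ∀ σ ∈ Icc h (2 * h) ×ˢ Icc h (2 * h),
      LipschitzOnWith L (twoJumpState phi Φ (4 * h) z σ) (closedBall 0 ρ) ∧
      K ⊆ twoJumpState phi Φ (4 * h) z σ '' closedBall 0 ρ := by
  obtain ⟨r, hr⟩ := hK.exists_norm_le
  obtain ⟨r₁, hr₁⟩ := exists_norm_hamiltonianFlow_le hΦ h0 2 r
  obtain ⟨h, M, hh, hh1, hshoot⟩ := exists_momentum_fst_hamiltonianFlow_eq hΦ h0 r₁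
  obtain ⟨r₂, hr₂⟩ := exists_norm_hamiltonianFlow_le hΦ h0 2 (max r₁ M)
  set ρ := (Real.sin phi)⁻¹ * (M + r₁) ⊔ (Real.sin phi)⁻¹ * (r₁ + r₂) with hρ
  obtain ⟨L₁, hL₁⟩ := exists_lipschitzOnWith_hamiltonianFlow hΦ h0 2 (r₁ + ρ)
  obtain ⟨r₃, hr₃⟩ := exists_norm_hamiltonianFlow_le hΦ h0 2 (r₁ + ρ)
  obtain ⟨L₂, hL₂⟩ := exists_lipschitzOnWith_hamiltonianFlow hΦ h0 2 (r₃ + ρ)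
  refine ⟨h, ρ, L₂ * (2 * max (L₁ * (2 * 1)) 1), hh, fun z hz σ hσ => ?_⟩
  obtain ⟨⟨h1, h2⟩, h3, h4⟩ := hσ
  have ha1 : |σ.1| ≤ 2 := by rw [abs_le]; constructor <;> linarith
  have ha2 : |σ.2| ≤ 2 := by rw [abs_le]; constructor <;> linarith
  have ha3 : |4 * h - (σ.1 + σ.2)| ≤ 2 := by rw [abs_le]; constructor <;> linarith
  set w := hamiltonianFlow Φ σ.1 z with hw
  have hwn : ‖w‖ ≤ r₁ := hr₁ _ ha1 z (hr z hz)
  constructor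
  · have hA : LipschitzOnWith (2 * 1) (fun ξ : Phase D => momentumRandomization phi w ξ.1)
        (closedBall 0 ρ) := by
      refine LipschitzWith.lipschitzOnWith
        ((lipschitzWith_momentumRandomization phi).comp (g := fun ξ : Phase D => (w, ξ.1)) ?_)
      simpa using (LipschitzWith.const (α := Phase D) w).prodMk
        (LipschitzWith.prod_fst (α := EuclideanSpace ℝ (Fin D)) (β := EuclideanSpace ℝ (Fin D)))
    have hAm : MapsTo (fun ξ : Phase D => momentumRandomization phi w ξ.1) (closedBall 0 ρ)
        (closedBall 0 (r₁ + ρ)) := fun ξ hξ => by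
      rw [mem_closedBall_zero_iff] at hξ ⊢
      exact (norm_momentumRandomization_le _ _ _).trans
        (add_le_add hwn ((norm_fst_le ξ).trans hξ))
    have hB := (hL₁ _ ha2).comp hA hAm
    have hBm : ∀ ξ ∈ closedBall (0 : Phase D) ρ,
        ‖hamiltonianFlow Φ σ.2 (momentumRandomization phi w ξ.1)‖ ≤ r₃ := fun ξ hξ =>
      hr₃ _ ha2 _ (mem_closedBall_zero_iff.1 (hAm hξ))
    have hsnd : LipschitzOnWith 1 (fun ξ : Phase D => ξ.2) (closedBall 0 ρ) :=
      LipschitzWith.prod_snd.lipschitzOnWith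
    have hC := (lipschitzWith_momentumRandomization phi).comp_lipschitzOnWith (hB.prodMk hsnd)
    refine (hL₂ _ ha3).comp hC fun ξ hξ => ?_
    rw [mem_closedBall_zero_iff]
    exact (norm_momentumRandomization_le _ _ _).trans
      (add_le_add (hBm ξ hξ) ((norm_snd_le ξ).trans (mem_closedBall_zero_iff.1 hξ)))
  · intro y hy
    set x := hamiltonianFlow Φ (-(4 * h - (σ.1 + σ.2))) y with hx
    have hxn : ‖x‖ ≤ r₁ := hr₁ _ (by rwa [abs_neg]) y (hr y hy)
    obtain ⟨p, hpM, hp⟩ := hshoot σ.2 ⟨h3, h4⟩ w.1 x.1 ((norm_fst_le w).trans hwn)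
      ((norm_fst_le x).trans hxn)
    set u := hamiltonianFlow Φ σ.2 (w.1, p) with hu
    have hun : ‖u‖ ≤ r₂ := hr₂ _ ha2 _
      (max_le_max ((norm_fst_le w).trans hwn) hpM)
    refine ⟨((Real.sin phi)⁻¹ • (p - Real.cos phi • w.2),
      (Real.sin phi)⁻¹ • (x.2 - Real.cos phi • u.2)), ?_, ?_⟩
    · have hi := (inv_pos.2 hsin).le
      rw [mem_closedBall_zero_iff]
      refine max_le_max ((norm_inv_sin_smul_sub_le hsin _ _).trans ?_)
        ((norm_inv_sin_smul_sub_le hsin _ _).trans ?_)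
      · exact mul_le_mul_of_nonneg_left (add_le_add hpM ((norm_snd_le w).trans hwn)) hi
      · exact mul_le_mul_of_nonneg_left
          (add_le_add ((norm_snd_le x).trans hxn) ((norm_snd_le u).trans hun)) hi
    · simp only [twoJumpState]
      rw [← hw, momentumRandomization_eq hsin.ne', ← hu, momentumRandomization_eq hsin.ne', hp,
        hx, hamiltonianFlow_hamiltonianFlow_neg hΦ h0]

theorem continuous_twoJumpState {phi : ℝ} {Φ : EuclideanSpace ℝ (Fin D) → ℝ}
    (hΦ : ContDiff ℝ 2 Φ) (h0 : ∀ q, 0 ≤ Φ q) (t : ℝ) (z : Phase D) :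
    Continuous fun x : (ℝ × ℝ) × Phase D => twoJumpState phi Φ t z x.1 x.2 := by
  have hF := continuous_hamiltonianFlow hΦ h0
  have hΓ := (lipschitzWith_momentumRandomization (D := D) phi).continuous
  have hc : Continuous fun x : (ℝ × ℝ) × Phase D => hamiltonianFlow Φ x.1.1 z :=
    hF.comp (g := fun y : ℝ × Phase D => hamiltonianFlow Φ y.1 y.2)
      (f := fun x : (ℝ × ℝ) × Phase D => (x.1.1, z)) (by fun_prop)
  have hc1 := hΓ.comp (hc.prodMk (continuous_fst.comp continuous_snd))
  have hc2 := hF.comp ((continuous_snd.comp continuous_fst).prodMk hc1)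
  have hc3 := hΓ.comp (hc2.prodMk (continuous_snd.comp continuous_snd))
  exact hF.comp (g := fun y : ℝ × Phase D => hamiltonianFlow Φ y.1 y.2)
    (Continuous.prodMk (f := fun x : (ℝ × ℝ) × Phase D => t - (x.1.1 + x.1.2)) (by fun_prop) hc3)

/-! ### The law of the process -/

theorem measurable_jumpTime (n : ℕ) : Measurable fun ω : Noise D => jumpTime ω n := by
  unfold jumpTime
  fun_prop

/-- The second alternative is the null event that all randomizations occur up to time `t`, on which
the infimum defining `jumpCount` is that of the empty set. -/
theorem jumpCount_eq_iff (ω : Noise D) (t : ℝ) (n : ℕ) :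
    jumpCount ω t = n ↔ (t < jumpTime ω (n + 1) ∧ ∀ m < n, ¬ t < jumpTime ω (m + 1)) ∨
      (n = 0 ∧ ∀ m, ¬ t < jumpTime ω (m + 1)) := by
  unfold jumpCount
  constructor
  · rintro rfl
    rcases eq_empty_or_nonempty {n : ℕ | t < jumpTime ω (n + 1)} with h | h
    · right
      rw [h]
      exact ⟨Nat.sInf_empty, fun m hm => notMem_empty m (h ▸ hm)⟩
    · left
      exact ⟨Nat.sInf_mem h, fun m hm => Nat.notMem_of_lt_sInf hm⟩
  · rintro (⟨h1, h2⟩ | ⟨rfl, h⟩)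
    · refine le_antisymm (Nat.sInf_le h1) (not_lt.1 fun hlt => ?_)
      exact h2 _ hlt (Nat.sInf_mem (s := {n : ℕ | t < jumpTime ω (n + 1)}) ⟨n, h1⟩)
    · rw [show {n : ℕ | t < jumpTime ω (n + 1)} = ∅ from eq_empty_of_forall_notMem h,
        Nat.sInf_empty]

theorem measurable_jumpCount (t : ℝ) : Measurable fun ω : Noise D => jumpCount ω t := by
  refine measurable_to_countable' fun n => ?_
  have hm : ∀ m, MeasurableSet {ω : Noise D | t < jumpTime ω (m + 1)} := fun m =>
    measurableSet_lt measurable_const (measurable_jumpTime _)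
  have : (fun ω : Noise D => jumpCount ω t) ⁻¹' {n} =
      ({ω | t < jumpTime ω (n + 1)} ∩ ⋂ m < n, {ω | t < jumpTime ω (m + 1)}ᶜ) ∪
      ({_ω | n = 0} ∩ ⋂ m, {ω | t < jumpTime ω (m + 1)}ᶜ) := by
    ext ω
    simp [jumpCount_eq_iff]
  rw [this]
  exact ((hm n).inter (.iInter fun m => .iInter fun _ => (hm m).compl)).union
    ((MeasurableSet.const _).inter (.iInter fun m => (hm m).compl))

theorem measurable_postJumpState {phi : ℝ} {Φ : EuclideanSpace ℝ (Fin D) → ℝ}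
    (hΦ : ContDiff ℝ 2 Φ) (h0 : ∀ q, 0 ≤ Φ q) (z : Phase D) (n : ℕ) :
    Measurable fun ω : Noise D => postJumpState phi Φ z ω n := by
  induction n with
  | zero => exact measurable_const
  | succ n ih =>
    have h1 : Measurable fun ω : Noise D =>
        hamiltonianFlow Φ (ω n).1 (postJumpState phi Φ z ω n) :=
      (continuous_hamiltonianFlow hΦ h0).measurable.comp
        ((measurable_pi_apply n).fst.prodMk ih)
    exact (lipschitzWith_momentumRandomization phi).continuous.measurable.comp
      (h1.prodMk (measurable_pi_apply n).snd)

/-- Without measurability the push-forward that defines `transition` would be zero. -/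
theorem measurable_process {phi : ℝ} {Φ : EuclideanSpace ℝ (Fin D) → ℝ}
    (hΦ : ContDiff ℝ 2 Φ) (h0 : ∀ q, 0 ≤ Φ q) (z : Phase D) (t : ℝ) :
    Measurable (process phi Φ z t) := by
  have h : Measurable fun x : ℕ × Noise D =>
      hamiltonianFlow Φ (t - jumpTime x.2 x.1) (postJumpState phi Φ z x.2 x.1) :=
    measurable_from_prod_countable_right fun n =>
      (continuous_hamiltonianFlow hΦ h0).measurable.comp
        ((measurable_const.sub (measurable_jumpTime n)).prodMk
          (measurable_postJumpState hΦ h0 z n))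
  exact h.comp ((measurable_jumpCount t).prodMk measurable_id)

/-- The process on the event of exactly two randomizations before time `t`. -/
theorem process_eq_twoJumpState (phi : ℝ) (Φ : EuclideanSpace ℝ (Fin D) → ℝ) (z : Phase D)
    {t : ℝ} {ω : Noise D} (h0 : 0 ≤ (ω 0).1) (h1 : 0 ≤ (ω 1).1) (h01 : (ω 0).1 + (ω 1).1 ≤ t)
    (h2 : t < (ω 2).1) :
    process phi Φ z t ω = twoJumpState phi Φ t z ((ω 0).1, (ω 1).1) ((ω 0).2, (ω 1).2) := by
  have hcount : jumpCount ω t = 2 := by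
    rw [jumpCount_eq_iff]
    refine Or.inl ⟨?_, fun m hm => ?_⟩
    · simp only [jumpTime, Finset.sum_range_succ, Finset.sum_range_zero]
      linarith
    · interval_cases m <;> simp only [jumpTime, Finset.sum_range_succ, Finset.sum_range_zero] <;>
        linarith
  rw [process, hcount]
  simp [jumpTime, Finset.sum_range_succ, postJumpState, twoJumpState]

/-- The exchange of the middle factors of a product of four measures. -/
theorem measurePreserving_prodProdProdComm {α β γ δ : Type*} [MeasurableSpace α]
    [MeasurableSpace β] [MeasurableSpace γ] [MeasurableSpace δ] (μ : Measure α) (ν : Measure β)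
    (ρ : Measure γ) (τ : Measure δ) [SigmaFinite μ] [SigmaFinite ν] [SigmaFinite ρ]
    [SigmaFinite τ] :
    MeasurePreserving (fun x : (α × β) × γ × δ => ((x.1.1, x.2.1), (x.1.2, x.2.2)))
      ((μ.prod ν).prod (ρ.prod τ)) ((μ.prod ρ).prod (ν.prod τ)) := by
  have h1 := measurePreserving_prodAssoc μ ν (ρ.prod τ)
  have h2 := (measurePreserving_prodAssoc ν ρ τ).symm
  have h3 := (Measure.measurePreserving_swap (μ := ν) (ν := ρ)).prod (MeasurePreserving.id τ)
  have h4 := measurePreserving_prodAssoc ρ ν τ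
  have h5 := (measurePreserving_prodAssoc μ ρ (ν.prod τ)).symm
  exact h5.comp (((MeasurePreserving.id μ).prod (h4.comp (h3.comp h2))).comp h1)

theorem map_noiseMeasure {lam : ℝ} (hlam : 0 < lam) :
    (noiseMeasure D lam).map (fun ω => ((ω 0, ω 1), ω 2)) =
      (((expMeasure lam⁻¹).prod (stdGaussian (EuclideanSpace ℝ (Fin D)))).prod
        ((expMeasure lam⁻¹).prod (stdGaussian (EuclideanSpace ℝ (Fin D))))).prod
        ((expMeasure lam⁻¹).prod (stdGaussian (EuclideanSpace ℝ (Fin D)))) := by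
  have := isProbabilityMeasure_expMeasure (inv_pos.2 hlam)
  unfold noiseMeasure
  set ν := (expMeasure lam⁻¹).prod (stdGaussian (EuclideanSpace ℝ (Fin D)))
  have hind : iIndepFun (fun (i : ℕ) (ω : Noise D) => ω i) (Measure.infinitePi fun _ : ℕ => ν) :=
    iIndepFun_infinitePi (X := fun _ x => x) fun _ => measurable_id
  have h := hind.indepFun_prodMk (fun i => measurable_pi_apply i) 0 1 2 (by norm_num) (by norm_num)
  rw [(indepFun_iff_map_prod_eq_prod_map_map
      ((measurable_pi_apply 0).prodMk (measurable_pi_apply 1)).aemeasurable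
      (measurable_pi_apply 2).aemeasurable).1 h,
    Measure.infinitePi_map_eval_prod (P := fun _ => ν) (by norm_num : (0 : ℕ) ≠ 1),
    Measure.infinitePi_map_eval]

/-- On a bounded set the transition probabilities dominate a common multiple of Lebesgue measure
restricted to the set: already the event that there are exactly two momentum randomizations, with
waiting times in `[h, 2h]`, contributes such a multiple. -/
theorem exists_smul_restrict_le_transition {lam phi : ℝ} (hlam : 0 < lam)
    (hsin : 0 < Real.sin phi) {Φ : EuclideanSpace ℝ (Fin D) → ℝ} (hΦ : ContDiff ℝ 2 Φ)
    (h0 : ∀ q, 0 ≤ Φ q) {K : Set (Phase D)} (hK : Bornology.IsBounded K) :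
    ∃ (κ : ℝ≥0∞) (t : ℝ), κ ≠ 0 ∧ 0 < t ∧
      ∀ z ∈ K, κ • volume.restrict K ≤ transition lam phi Φ t z := by
  obtain ⟨h, ρ, L, hh, hLK⟩ := exists_lipschitzOnWith_twoJumpState hsin hΦ h0 hK
  have : (volume : Measure (Phase D)).IsAddHaarMeasure :=
    inferInstanceAs ((volume : Measure (EuclideanSpace ℝ (Fin D))).prod volume).IsAddHaarMeasure
  obtain ⟨c, hc, hcle⟩ := exists_smul_restrict_le_prod_stdGaussian (D := D) ρ
  have hprob := isProbabilityMeasure_expMeasure (inv_pos.2 hlam)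
  set e := expMeasure lam⁻¹ with he
  set g := stdGaussian (EuclideanSpace ℝ (Fin D)) with hg
  set c' := c / (L + 1 : ℝ≥0∞) ^ Module.finrank ℝ (Phase D) with hc'
  have hc'0 : c' ≠ 0 := (ENNReal.div_pos hc (by finiteness)).ne'
  have heI : e (Icc h (2 * h)) ≠ 0 := by
    refine expMeasure_ne_zero (inv_pos.2 hlam) (fun x hx => hh.trans_le hx.1) ?_
    rw [Real.volume_Icc]
    simpa using by linarith
  have heT : e (Ioi (4 * h)) ≠ 0 := by
    refine expMeasure_ne_zero (inv_pos.2 hlam) (fun x hx => ?_) (by simp)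
    exact (by linarith : 0 < 4 * h).trans hx
  set J := Icc h (2 * h) ×ˢ Icc h (2 * h) with hJ
  have hJm : MeasurableSet J := measurableSet_Icc.prod measurableSet_Icc
  refine ⟨c' * (e.prod e) J * e (Ioi (4 * h)), 4 * h, ?_, by linarith, fun z hz => ?_⟩
  · rw [hJ, Measure.prod_prod]
    exact mul_ne_zero (mul_ne_zero hc'0 (mul_ne_zero heI heI)) heT
  refine Measure.le_iff.2 fun A hA => ?_
  have hGm : Measurable fun x : (ℝ × ℝ) × Phase D => twoJumpState phi Φ (4 * h) z x.1 x.2 :=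
    (continuous_twoJumpState hΦ h0 _ z).measurable
  -- The two-jump event, with waiting times and Gaussian vectors separated and as they come.
  set S : Set ((ℝ × ℝ) × Phase D) :=
    {x | x.1 ∈ J ∧ twoJumpState phi Φ (4 * h) z x.1 x.2 ∈ A} with hS
  have hSm : MeasurableSet S := (measurable_fst hJm).inter (hGm hA)
  set T : Set ((ℝ × EuclideanSpace ℝ (Fin D)) × (ℝ × EuclideanSpace ℝ (Fin D))) :=
    (fun x => ((x.1.1, x.2.1), (x.1.2, x.2.2))) ⁻¹' S with hT
  have hTm : MeasurableSet T := (measurePreserving_prodProdProdComm e g e g).measurable hSm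
  have hlow : c' * volume.restrict K A * (e.prod e) J ≤ ((e.prod e).prod (g.prod g)) S := by
    rw [Measure.prod_apply hSm, ← setLIntegral_const]
    refine le_trans (setLIntegral_mono' hJm fun σ hσ => ?_) (setLIntegral_le_lintegral J _)
    have h1 := smul_restrict_le_map_of_lipschitzOnWith hcle
      (hGm.comp measurable_prodMk_left) (hLK z hz σ hσ).1 (hLK z hz σ hσ).2 A
    rw [Measure.map_apply (hGm.comp measurable_prodMk_left) hA] at h1
    exact h1.trans (measure_mono fun ξ hξ => ⟨hσ, hξ⟩)
  have hTS : ((e.prod g).prod (e.prod g)) T = ((e.prod e).prod (g.prod g)) S :=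
    (measurePreserving_prodProdProdComm e g e g).measure_preimage hSm.nullMeasurableSet
  have hX : Measurable fun ω : Noise D => ((ω 0, ω 1), ω 2) := by fun_prop
  have hsub : (fun ω : Noise D => ((ω 0, ω 1), ω 2)) ⁻¹' (T ×ˢ (Ioi (4 * h) ×ˢ univ)) ⊆
      process phi Φ z (4 * h) ⁻¹' A := by
    rintro ω ⟨⟨⟨hσ1, hσ2⟩, hω⟩, h3, -⟩
    have h1 : h ≤ (ω 0).1 ∧ (ω 0).1 ≤ 2 * h := hσ1
    have h2 : h ≤ (ω 1).1 ∧ (ω 1).1 ≤ 2 * h := hσ2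
    rw [mem_preimage, process_eq_twoJumpState phi Φ z (by linarith) (by linarith) (by linarith) h3]
    exact hω
  rw [transition, Measure.map_apply (measurable_process hΦ h0 z _) hA, Measure.smul_apply,
    smul_eq_mul]
  calc c' * (e.prod e) J * e (Ioi (4 * h)) * volume.restrict K A
      = c' * volume.restrict K A * (e.prod e) J * e (Ioi (4 * h)) := by ring
    _ ≤ ((e.prod g).prod (e.prod g)) T * e (Ioi (4 * h)) := by
        rw [hTS]
        gcongr
    _ = (((e.prod g).prod (e.prod g)).prod (e.prod g)) (T ×ˢ (Ioi (4 * h) ×ˢ univ)) := by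
        simp only [Measure.prod_prod, measure_univ, mul_one]
    _ = noiseMeasure D lam ((fun ω : Noise D => ((ω 0, ω 1), ω 2)) ⁻¹'
          (T ×ˢ (Ioi (4 * h) ×ˢ univ))) := by
        rw [← map_noiseMeasure hlam, Measure.map_apply hX
          (hTm.prod (measurableSet_Ioi.prod MeasurableSet.univ))]
    _ ≤ _ := measure_mono hsub

end RHMC

end

/-- Minorization condition for randomized Hamiltonian Monte Carlo on compact sets. -/
theorem mainTheorem3 (D : ℕ) (lam phi : ℝ) (hlam : 0 < lam) (hphi : 0 < phi)
    (hphi' : phi ≤ Real.pi / 2) (Φ : EuclideanSpace ℝ (Fin D) → ℝ)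
    (hΦ : RHMC.PotentialHypothesis lam phi Φ)
    (K : Set (RHMC.Phase D)) (hK : IsCompact K) :
    ∃ (η : Measure (RHMC.Phase D)) (ε t : ℝ),
      IsProbabilityMeasure η ∧ (0 < volume K → η K = 1) ∧ 0 < ε ∧ 0 < t ∧
        ∀ z ∈ K, ENNReal.ofReal ε • η ≤ RHMC.transition lam phi Φ t z := by
  have hsin : 0 < Real.sin phi :=
    Real.sin_pos_of_pos_of_lt_pi hphi (by linarith [Real.pi_pos])
  -- Adjoining a ball covers the case that `K` is a null set.
  have hK' : IsCompact (K ∪ Metric.closedBall 0 1) := hK.union (isCompact_closedBall _ _)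
  obtain ⟨κ, t, hκ, ht, hle⟩ :=
    RHMC.exists_smul_restrict_le_transition hlam hsin hΦ.contDiff hΦ.nonneg hK'.isBounded
  obtain ⟨S, hSK, hS0, hKS⟩ : ∃ S ⊆ K ∪ Metric.closedBall 0 1, volume S ≠ 0 ∧
      (0 < volume K → S = K) := by
    by_cases h : 0 < volume K
    · exact ⟨K, Set.subset_union_left, h.ne', fun _ => rfl⟩
    · exact ⟨_, Set.subset_union_right,
        (Metric.measure_closedBall_pos volume 0 one_pos).ne', fun h' => absurd h' h⟩
  have hStop : volume S ≠ ⊤ := ((measure_mono hSK).trans_lt hK'.measure_lt_top).ne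
  have hprod : min κ 1 * volume S ≠ ⊤ := ENNReal.mul_ne_top (by simp) hStop
  have hprod0 : min κ 1 * volume S ≠ 0 := mul_ne_zero (by simp [hκ]) hS0
  refine ⟨(volume S)⁻¹ • volume.restrict S, (min κ 1 * volume S).toReal, t, ⟨?_⟩, fun h => ?_,
    ENNReal.toReal_pos hprod0 hprod, ht, fun z hz => ?_⟩
  · simp [ENNReal.inv_mul_cancel hS0 hStop]
  · rw [hKS h] at hS0 hStop ⊢
    simp [ENNReal.inv_mul_cancel hS0 hStop]
  · rw [ENNReal.ofReal_toReal hprod, smul_smul, mul_assoc, ENNReal.mul_inv_cancel hS0 hStop,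
      mul_one]
    refine le_trans ?_ (hle z (Or.inl hz))
    refine Measure.le_iff'.2 fun A => ?_
    simp only [Measure.smul_apply, smul_eq_mul]
    gcongr
    exact min_le_left _ _
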